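/- **Work as a Stage II currency in quantum thermodynamics.** Let $d\ge 2$, $\Delta>0$ and $\beta>0$. Let $S$ and $W$ (the wallet) be quantum systems of dimension $d$ with identical, equally spaced Hamiltonians $H_S$ and $H_W$, where $H=\sum_{k=1}^d E_k\,|E_k\rangle\langle E_k|$ with $E_k=k\Delta$. Let $\Omega$ be the set of all density operators on $S\otimes W$. A *specification* is a non-empty subset of $\Omega$. Allowed transformations are the thermal operations at inverse temperature $\beta$: the maps $\rho\mapsto \mathrm{Tr}_B\big[U(\rho\otimes\gamma_B)U^\dagger\big]$ on $\Omega$, where $B$ is any bath with Hamiltonian $H_B$ and finite partition function $Z=\mathrm{Tr}\,e^{-\beta H_B}$ (its Hilbert space may be infinite-dimensional), $\gamma_B=e^{-\beta H_B}/Z$, and $U$ is a unitary on $S\otimes W\otimes B$ that commutes with $H_S+H_W+H_B$. They act on specifications element-wise, and $V\to V'$ means that some thermal operation $f$ satisfies $f(V)\subseteq V'$. Let $C^k=\{\sigma\in\Omega: \mathrm{Tr}_S\,\sigma=|E_k\rangle\langle E_k|\}$ ("the wallet is in the energy eigenstate $E_k$") and $\mathcal C=\{C^1,\dots,C^d\}\cup\{\Omega\}$.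 Let the target $\mathcal S$ consist of $\Omega$ and of the sets $\{\sigma\in\Omega:\mathrm{Tr}_W\,\sigma=\rho\}$, for all density operators $\rho$ on $S$ that are block-diagonal in energy, i.e. commute with $H_S$. Then $\mathcal C$ is an independent (Stage II) currency for $\mathcal S$, that is: 1. (Order) $\Omega\in\mathcal C$, and for all $C,C'\in\mathcal C$, $C\to C'$ or $C'\to C$. 2. (Universality) $\Omega\in\mathcal S$, and for every $V\in\mathcal S$ there are $C,C'\in\mathcal C$ with $C\to V$ and $V\to C'$. 3. (Compatibility) $C\cap V\neq\emptyset$ for all $C\in\mathcal C$ and $V\in\mathcal S$. 4. (Non-disturbance) For all $C,C'\in\mathcal C$, if $C\to C'$ then $C\cap V\to C'\cap V$ for every $V\in\mathcal S$. Moreover, $\operatorname{Val}(C^k)=E_k$, $\operatorname{Val}(\Omega)=0$ is a well-defined value function on $\mathcal C$: $\operatorname{Val}(C')\ge\operatorname{Val}(C)\iff C'\to C$ for all $C,C'\in\mathcal C$. -/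

import Mathlib

open scoped ComplexOrder ENNReal NNReal

noncomputable section

/-! ### Resource theories on specifications, currencies -/

/-- A resource theory on the specifications (sets of states) of a state space `Ω`: a set of allowed
transformations, each of which acts element-wise and sends non-empty specifications to non-empty
specifications. -/
structure ResourceTheory (Ω : Type*) where
  transformations : Set (Set Ω → Set Ω)
  elementwise : ∀ f ∈ transformations, ∀ V : Set Ω, f V = ⋃ ν ∈ V, f {ν}
  nonempty : ∀ f ∈ transformations, ∀ V : Set Ω, V.Nonempty → (f V).Nonempty

namespace ResourceTheory

variable {Ω : Type*}

/-- `V → W`: some allowed transformation sends `V` into `W`. -/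
def Reaches (T : ResourceTheory Ω) (V W : Set Ω) : Prop :=
  ∃ f ∈ T.transformations, f V ⊆ W

/-- `C` is a currency for the target `S`; the trivial specification `Ω` is `Set.univ`. -/
structure IsCurrency (T : ResourceTheory Ω) (C S : Set (Set Ω)) : Prop where
  nonempty_currency : ∀ c ∈ C, c.Nonempty
  nonempty_target : ∀ V ∈ S, V.Nonempty
  univ_mem_currency : Set.univ ∈ C
  univ_mem_target : Set.univ ∈ S
  order : ∀ c ∈ C, ∀ c' ∈ C, T.Reaches c c' ∨ T.Reaches c' c
  universal_cost : ∀ V ∈ S, ∃ c ∈ C, T.Reaches c V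
  universal_yield : ∀ V ∈ S, ∃ c ∈ C, T.Reaches V c

/-- The currency `C` is independent of the target `S`. -/
structure IsIndependent (T : ResourceTheory Ω) (C S : Set (Set Ω)) : Prop where
  compatible : ∀ c ∈ C, ∀ V ∈ S, (c ∩ V).Nonempty
  undisturbed : ∀ c ∈ C, ∀ c' ∈ C, T.Reaches c c' → ∀ V ∈ S, T.Reaches (c ∩ V) (c' ∩ V)

/-- A Stage II currency: a currency that is independent of its target. -/
def IsStageIICurrency (T : ResourceTheory Ω) (C S : Set (Set Ω)) : Prop :=
  T.IsCurrency C S ∧ T.IsIndependent C S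

/-- `val` is a value function on `C`: it represents the order by convertibility, and the trivial
specification has value zero. -/
structure IsValue (T : ResourceTheory Ω) (C : Set (Set Ω)) (val : C → ℝ≥0) : Prop where
  monotone : ∀ c c' : C, val c ≤ val c' ↔ T.Reaches c' c
  val_univ : ∀ h : Set.univ ∈ C, val ⟨Set.univ, h⟩ = 0

end ResourceTheory

/-! ### Quantum states and thermal operations -/

/-- Density matrices on `ℂ^n`. -/
structure QState (n : Type*) [Fintype n] where
  mat : Matrix n n ℂ
  posSemidef : mat.PosSemidef
  trace_eq_one : mat.trace = 1

/-- Partial trace over the first factor. -/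
def traceFst {m n : Type*} [Fintype m] (M : Matrix (m × n) (m × n) ℂ) : Matrix n n ℂ :=
  Matrix.of fun i j => ∑ k, M (k, i) (k, j)

/-- Partial trace over the second factor. -/
def traceSnd {m n : Type*} [Fintype n] (M : Matrix (m × n) (m × n) ℂ) : Matrix m m ℂ :=
  Matrix.of fun i j => ∑ k, M (i, k) (j, k)

/-- The matrix element `⟨p|U|q⟩` of an operator on `ℓ²(ι)` in the standard basis. -/
def matrixElement {ι : Type*}
    (U : lp (fun _ : ι => ℂ) 2 →L[ℂ] lp (fun _ : ι => ℂ) 2) (p q : ι) : ℂ :=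
  open scoped Classical in
  (U (lp.single 2 q (1 : ℂ)) : ι → ℂ) p

/-- The Gibbs weights `exp (-β e b) / Z` of a bath with energies `e`. -/
def gibbsWeight {B : Type} (β : ℝ) (e : B → ℝ) (b : B) : ℝ :=
  Real.exp (-β * e b) / ∑' b', Real.exp (-β * e b')

/-- The operator `K = ⟨b|U|b'⟩` on the system obtained from an operator `U` on system and bath. -/
def bathElement {X B : Type*}
    (U : lp (fun _ : X × B => ℂ) 2 →L[ℂ] lp (fun _ : X × B => ℂ) 2) (b b' : B) : Matrix X X ℂ :=
  Matrix.of fun x x' => matrixElement U (x, b) (x', b')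

/-- The state transformation `f` is a thermal operation at inverse temperature `β`, for a system
with energy eigenbasis `X` and eigenvalues `E`:
`f ρ = Tr_B [U (ρ ⊗ γ_B) U†]` where `γ_B` is the Gibbs state of a bath and `U` is an
energy-conserving unitary on system and bath.

The bath is written in its energy eigenbasis `B`, with arbitrary eigenvalues `e`. A Gibbs state
exists only if the partition function is finite, so that the bath Hamiltonian has pure point
spectrum, and the bath Hilbert space is `ℓ²(B)`. The system-bath Hamiltonian is then diagonal in
the product basis, and `U` commutes with it iff `U` has no matrix element between basis vectors of
different total energy. In this basis
`Tr_B [U (ρ ⊗ γ_B) U†] = ∑_{b, b'} γ_B(b') • ⟨b|U|b'⟩ ρ ⟨b|U|b'⟩†`. -/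
def IsThermalOperation {X : Type*} [Fintype X] (β : ℝ) (E : X → ℝ)
    (f : QState X → QState X) : Prop :=
  ∃ (B : Type) (_ : Nonempty B) (e : B → ℝ)
    (U : lp (fun _ : X × B => ℂ) 2 →L[ℂ] lp (fun _ : X × B => ℂ) 2),
    (Summable fun b => Real.exp (-β * e b)) ∧
    U ∈ unitary (lp (fun _ : X × B => ℂ) 2 →L[ℂ] lp (fun _ : X × B => ℂ) 2) ∧
    (∀ p q : X × B, E p.1 + e p.2 ≠ E q.1 + e q.2 → matrixElement U p q = 0) ∧
    ∀ ρ : QState X,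
      HasSum (fun b : B × B => (gibbsWeight β e b.2 : ℂ) •
        (bathElement U b.1 b.2 * ρ.mat * (bathElement U b.1 b.2).conjTranspose)) (f ρ).mat

/-- The resource theory of thermal operations; a state transformation acts on specifications by
taking images. -/
def thermalTheory {X : Type*} [Fintype X] (β : ℝ) (E : X → ℝ) :
    ResourceTheory (QState X) where
  transformations := {F | ∃ f, IsThermalOperation β E f ∧ F = Set.image f}
  elementwise := by
    rintro F ⟨f, -, rfl⟩ V
    ext y
    simp [eq_comm]
  nonempty := by
    rintro F ⟨f, -, rfl⟩ V hV
    exact hV.image f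

/-! ### Work as a currency

The global system is `S ⊗ W` with `S` (target) the first and `W` (wallet) the second factor, both
of dimension `d` and written in their energy eigenbases. -/

/-- The equally spaced energy levels `Δ, 2Δ, …, dΔ`. The index `k : Fin d` stands for the
`(k+1)`-st level. -/
def energyLevel (d : ℕ) (Δ : ℝ≥0) (k : Fin d) : ℝ≥0 := ((k : ℕ) + 1 : ℝ≥0) * Δ

/-- The Hamiltonian of each of the two subsystems. -/
def localHamiltonian (d : ℕ) (Δ : ℝ≥0) : Matrix (Fin d) (Fin d) ℂ :=
  Matrix.diagonal fun k => ((energyLevel d Δ k : ℝ) : ℂ)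

/-- The energies of `H_S ⊗ 1 + 1 ⊗ H_W` in the product eigenbasis. -/
def globalEnergy (d : ℕ) (Δ : ℝ≥0) (x : Fin d × Fin d) : ℝ :=
  energyLevel d Δ x.1 + energyLevel d Δ x.2

/-- The specification "the wallet is in the energy eigenstate `|E_k⟩⟨E_k|`". -/
def walletSpec (d : ℕ) (k : Fin d) : Set (QState (Fin d × Fin d)) :=
  {σ | traceFst σ.mat = Matrix.single k k 1}

/-- The currency: all wallet specifications together with the trivial specification. -/
def workCurrency (d : ℕ) : Set (Set (QState (Fin d × Fin d))) :=
  Set.range (walletSpec d) ∪ {Set.univ}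

/-- The local specification of a state `ρ` on `S`: all global states with marginal `ρ`. -/
def localSpec {d : ℕ} (ρ : QState (Fin d)) : Set (QState (Fin d × Fin d)) :=
  {σ | traceSnd σ.mat = ρ.mat}

/-- The target: the local specifications of all states on `S` that are block-diagonal with respect
to the Hamiltonian (i.e. commute with it), together with the trivial specification. -/
def blockDiagonalTarget (d : ℕ) (Δ : ℝ≥0) : Set (Set (QState (Fin d × Fin d))) :=
  {V | ∃ ρ : QState (Fin d), Commute ρ.mat (localHamiltonian d Δ) ∧ V = localSpec ρ} ∪ {Set.univ}

theorem walletSpec_mem (d : ℕ) (k : Fin d) : walletSpec d k ∈ workCurrency d :=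
  Or.inl ⟨k, rfl⟩

theorem univ_mem_workCurrency (d : ℕ) : Set.univ ∈ workCurrency d :=
  Or.inr rfl

end

/-! Possible conversions come from permuting product energy eigenstates of system and bath without
changing the total energy (`exists_isThermalOperation_perm`). The bath contains an infinite ladder
of spacing `Δ`, which absorbs any quanta the wallet gives up. Since the wallet starts in a known
level `k`, the exchange `(k, n) ↔ (j, n + k - j)` always takes effect on it and lowers it to `j`
without touching `S` (`exists_lower_wallet`). To prepare a diagonal `ρ` on `S`, the bath also holds
a label `a` whose Gibbs weights are the nonzero eigenvalues of `ρ`; the wallet is lowered from the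
top to level `a`, then exchanged with `S`, which is free because the two Hamiltonians agree
(`exists_prepare_local`).

Impossible conversions are excluded by `IsThermalOperation.sum_exp_le`: a thermal operation that
carries one set of energy eigenstates into the span of another cannot decrease the sum of `exp (-β
E)`. Applied to wallet specifications, the partition function of `S` cancels. Thus the wallet cannot
be raised, and for `d ≥ 2` the trivial specification reaches no eigenstate. Every possible
conversion is therefore a lowering, which preserves the marginal on `S`, or a conversion to the
trivial specification; this gives non-disturbance. -/

/-! ### Energy-conserving permutations induce thermal operations -/

/-- The unitary on `ℓ²(ι)` that permutes the standard basis. -/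
noncomputable def lpPerm {ι : Type*} (π : Equiv.Perm ι) :
    lp (fun _ : ι => ℂ) 2 ≃ₗᵢ[ℂ] lp (fun _ : ι => ℂ) 2 where
  toFun f := ⟨fun i => f (π.symm i), 
    memℓp_gen (π.symm.summable_iff.mpr ((lp.memℓp f).summable (by simp)))⟩
  invFun f := ⟨fun i => f (π i), 
    memℓp_gen (π.summable_iff.mpr ((lp.memℓp f).summable (by simp)))⟩
  map_add' _ _ := rfl
  map_smul' _ _ := rfl
  left_inv f := by ext i; simp
  right_inv f := by ext i; simp
  norm_map' f := by
    have h2 : (0 : ℝ) < (2 : ℝ≥0∞).toReal := by simp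
    rw [lp.norm_eq_tsum_rpow h2, lp.norm_eq_tsum_rpow h2]
    congr 1
    exact π.symm.tsum_eq fun i => ‖(f : ι → ℂ) i‖ ^ (2 : ℝ≥0∞).toReal

open scoped Classical in
theorem matrixElement_lpPerm {ι : Type*} (π : Equiv.Perm ι) (p q : ι) :
    matrixElement (lpPerm π : lp (fun _ : ι => ℂ) 2 →L[ℂ] lp (fun _ : ι => ℂ) 2) p q =
      if p = π q then 1 else 0 := by
  change (lp.single 2 q (1 : ℂ) : ι → ℂ) (π.symm p) = _
  rw [lp.coeFn_single, Pi.single_apply]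
  simp only [Equiv.symm_apply_eq]

theorem gibbsWeight_nonneg {B : Type} (β : ℝ) (e : B → ℝ) (b : B) : 0 ≤ gibbsWeight β e b :=
  div_nonneg (Real.exp_nonneg _) (tsum_nonneg fun _ => Real.exp_nonneg _)

theorem tsum_exp_pos {B : Type} [Nonempty B] {β : ℝ} {e : B → ℝ}
    (he : Summable fun b => Real.exp (-β * e b)) : 0 < ∑' b, Real.exp (-β * e b) :=
  he.tsum_pos (fun _ => Real.exp_nonneg _) (Classical.arbitrary B) (Real.exp_pos _)

theorem hasSum_gibbsWeight {B : Type} [Nonempty B] {β : ℝ} {e : B → ℝ}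
    (he : Summable fun b => Real.exp (-β * e b)) : HasSum (gibbsWeight β e) 1 := by
  have h := he.hasSum.div_const (∑' b, Real.exp (-β * e b))
  rwa [div_self (tsum_exp_pos he).ne'] at h

/-- Positive semidefiniteness passes to infinite sums. -/
theorem Matrix.posSemidef_of_hasSum {ι n : Type*} [Fintype n] {g : ι → Matrix n n ℂ}
    {M : Matrix n n ℂ} (h : HasSum g M) (hg : ∀ i, (g i).PosSemidef) : M.PosSemidef := by
  rw [Matrix.posSemidef_iff_dotProduct_mulVec]
  constructor
  · have h' := h.matrix_conjTranspose
    simp only [(hg _).isHermitian.eq] at h'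
    exact h'.unique h
  · intro x
    have hc : Continuous fun N : Matrix n n ℂ => star x ⬝ᵥ N.mulVec x := by fun_prop
    let φ : Matrix n n ℂ →+ ℂ :=
      { toFun := fun N => star x ⬝ᵥ N.mulVec x
        map_zero' := by simp
        map_add' := fun A B => by simp [Matrix.add_mulVec, dotProduct_add] }
    exact (h.map φ hc).nonneg fun i => (hg i).dotProduct_mulVec_nonneg x

section Permutation

variable {X : Type*} [Fintype X] {B : Type}

open scoped Classical in
/-- The matrix of `∑_b ⟨b|U|b'⟩ M ⟨b|U|b'⟩†` for the unitary `U` that permutes the standard basis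
by `π`. -/
noncomputable def permBranch (π : Equiv.Perm (X × B)) (M : Matrix X X ℂ) (b' : B) : Matrix X X ℂ :=
  Matrix.of fun x y => ∑ x', ∑ y',
    if (π (x', b')).1 = x ∧ π (y', b') = (y, (π (x', b')).2) then M x' y' else 0

/-- On the diagonal the two conditions say `π (y', b') = π (x', b')`, so injectivity of `π` leaves
only `y' = x'`, counted for exactly one `x`. -/
theorem trace_permBranch (π : Equiv.Perm (X × B)) (M : Matrix X X ℂ) (b' : B) :
    (permBranch π M b').trace = M.trace := by
  classical
  simp only [permBranch, Matrix.trace, Matrix.diag_apply, Matrix.of_apply]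
  rw [Finset.sum_comm]
  refine Finset.sum_congr rfl fun x' _ => ?_
  rw [Finset.sum_comm]
  rw [Finset.sum_eq_single x']
  · simp [Prod.ext_iff]
  · intro y' _ hy
    refine Finset.sum_eq_zero fun x _ => if_neg ?_
    rintro ⟨rfl, h⟩
    exact hy (by simpa using h)
  · simp

/-- This turns the sum over pairs of bath states that defines a thermal operation into a sum over
input states `b'` alone: a permutation determines the output bath state. -/
theorem hasSum_permBranch (π : Equiv.Perm (X × B)) {w : B → ℝ} (hw0 : ∀ b, 0 ≤ w b)
    (hw : Summable w) (M : Matrix X X ℂ) :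
    ∃ N : Matrix X X ℂ, HasSum (fun b' => (w b' : ℂ) • permBranch π M b') N ∧
      HasSum (fun b : B × B => (w b.2 : ℂ) •
        (bathElement (lpPerm π : lp (fun _ : X × B => ℂ) 2 →L[ℂ] lp (fun _ : X × B => ℂ) 2)
          b.1 b.2 * M *
        (bathElement (lpPerm π : lp (fun _ : X × B => ℂ) 2 →L[ℂ] lp (fun _ : X × B => ℂ) 2)
          b.1 b.2).conjTranspose)) N := by
  classical
  have key : ∀ x y x' y', Summable fun b' => (w b' : ℂ) *
      (if (π (x', b')).1 = x ∧ π (y', b') = (y, (π (x', b')).2) then M x' y' else 0) := by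
    intro x y x' y'
    refine Summable.of_norm_bounded (hw.mul_right ‖M x' y'‖) fun b' => ?_
    rw [norm_mul, Complex.norm_real, Real.norm_of_nonneg (hw0 b')]
    refine mul_le_mul_of_nonneg_left ?_ (hw0 b')
    split_ifs <;> simp
  refine ⟨Matrix.of fun x y => ∑ x', ∑ y', ∑' b', (w b' : ℂ) *
      (if (π (x', b')).1 = x ∧ π (y', b') = (y, (π (x', b')).2) then M x' y' else 0), ?_, ?_⟩
  · refine Pi.hasSum.2 fun x => Pi.hasSum.2 fun y => ?_
    simp only [permBranch, Matrix.smul_apply, Matrix.of_apply, smul_eq_mul, Finset.mul_sum]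
    exact hasSum_sum fun x' _ => hasSum_sum fun y' _ => (key x y x' y').hasSum
  · refine Pi.hasSum.2 fun x => Pi.hasSum.2 fun y => ?_
    have hterm : ∀ b : B × B, ((w b.2 : ℂ) •
        (bathElement (lpPerm π : lp (fun _ : X × B => ℂ) 2 →L[ℂ] lp (fun _ : X × B => ℂ) 2)
          b.1 b.2 * M *
        (bathElement (lpPerm π : lp (fun _ : X × B => ℂ) 2 →L[ℂ] lp (fun _ : X × B => ℂ) 2)
          b.1 b.2).conjTranspose)) x y = ∑ x', ∑ y', (w b.2 : ℂ) *
            (if (x, b.1) = π (x', b.2) ∧ (y, b.1) = π (y', b.2) then M x' y' else 0) := by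
      intro b
      simp only [bathElement, matrixElement_lpPerm, Matrix.smul_apply, Matrix.mul_apply,
        Matrix.of_apply, Matrix.conjTranspose_apply, smul_eq_mul, Finset.mul_sum, Finset.sum_mul]
      rw [Finset.sum_comm]
      refine Finset.sum_congr rfl fun x' _ => Finset.sum_congr rfl fun y' _ => ?_
      by_cases h1 : (x, b.1) = π (x', b.2) <;> by_cases h2 : (y, b.1) = π (y', b.2) <;>
        simp [h1, h2]
    simp only [hterm, Matrix.of_apply]
    refine hasSum_sum fun x' _ => hasSum_sum fun y' _ => ?_
    -- For fixed `x'` and `y'` only pairs on the graph `b = (π (x', b')).2` contribute.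
    have hinj : Function.Injective fun b' : B => ((π (x', b')).2, b') :=
      fun a b h => (Prod.ext_iff.1 h).2
    refine (hinj.hasSum_iff ?_).1 ?_
    · rintro ⟨b, b'⟩ hb
      rw [if_neg, mul_zero]
      rintro ⟨h, -⟩
      exact hb ⟨b', by simp [← h]⟩
    · convert (key x y x' y').hasSum using 4 with b'
      simp only [Prod.ext_iff]
      grind

/-- An energy-conserving permutation of the product eigenbasis of system and bath defines a thermal
operation. -/
theorem exists_isThermalOperation_perm [Nonempty B] {β : ℝ} {E : X → ℝ} {e : B → ℝ}
    (he : Summable fun b => Real.exp (-β * e b)) (π : Equiv.Perm (X × B))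
    (hπ : ∀ q, E (π q).1 + e (π q).2 = E q.1 + e q.2) :
    ∃ f : QState X → QState X, IsThermalOperation β E f ∧
      ∀ ρ, HasSum (fun b' => (gibbsWeight β e b' : ℂ) • permBranch π ρ.mat b') (f ρ).mat := by
  classical
  choose N hN hN' using fun M : Matrix X X ℂ =>
    hasSum_permBranch π (gibbsWeight_nonneg β e) (hasSum_gibbsWeight he).summable M
  refine ⟨fun ρ => ⟨N ρ.mat, ?_, ?_⟩, ⟨B, inferInstance, e, lpPerm π, he, ?_, ?_, ?_⟩, ?_⟩
  · refine Matrix.posSemidef_of_hasSum (hN' ρ.mat) fun b => ?_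
    exact (ρ.posSemidef.mul_mul_conjTranspose_same _).smul
      (Complex.zero_le_real.2 (gibbsWeight_nonneg _ _ _))
  · have h1 := (hN ρ.mat).map (Matrix.traceAddMonoidHom X ℂ) (by
      change Continuous fun M : Matrix X X ℂ => M.trace
      fun_prop)
    have h2 := Complex.hasSum_ofReal.2 (hasSum_gibbsWeight he)
    rw [Complex.ofReal_one] at h2
    refine h1.unique (h2.congr_fun fun b => ?_)
    change ((gibbsWeight β e b : ℂ) • permBranch π ρ.mat b).trace = _
    rw [Matrix.trace_smul, trace_permBranch, ρ.trace_eq_one, smul_eq_mul, mul_one]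
  · exact (Unitary.linearIsometryEquiv.symm (lpPerm π)).2
  · intro p q h
    rw [matrixElement_lpPerm, if_neg]
    rintro rfl
    exact h (hπ q)
  · exact fun ρ => hN' ρ.mat
  · exact fun ρ => hN ρ.mat

end Permutation

/-! ### States with the wallet in an energy eigenstate -/

/-- A positive semidefinite matrix annihilates any vector on which its quadratic form vanishes; here
the vector is the `i`-th basis vector. -/
theorem Matrix.PosSemidef.apply_eq_zero_of_diag {n : Type*} [Fintype n] {M : Matrix n n ℂ}
    (hM : M.PosSemidef) {i : n} (hi : M i i = 0) (j : n) : M i j = 0 := by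
  classical
  have h := (hM.dotProduct_mulVec_zero_iff (Pi.single i 1)).1 (by simpa using hi)
  have h' := congrFun h j
  rw [Matrix.mulVec_single_one] at h'
  have h2 : M j i = 0 := by simpa using h'
  rw [← hM.isHermitian.apply, h2, star_zero]

/-- Purity of the wallet marginal confines `σ` to `S ⊗ |k⟩`: for `w ≠ k` the nonnegative diagonal
entries with wallet index `w` sum to zero, so each vanishes together with its row and column. -/
theorem apply_eq_zero_of_mem_walletSpec {d : ℕ} {k : Fin d} {σ : QState (Fin d × Fin d)}
    (hσ : σ ∈ walletSpec d k) {x : Fin d × Fin d} (hx : x.2 ≠ k) (y : Fin d × Fin d) :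
    σ.mat x y = 0 ∧ σ.mat y x = 0 := by
  have h : ∑ i, σ.mat (i, x.2) (i, x.2) = 0 := by
    have := congrFun (congrFun hσ x.2) x.2
    rwa [Matrix.single_apply, if_neg (by tauto)] at this
  have h0 : σ.mat x x = 0 :=
    (Finset.sum_eq_zero_iff_of_nonneg fun i _ => σ.posSemidef.diag_nonneg).1 h x.1
      (Finset.mem_univ _)
  have h1 := σ.posSemidef.apply_eq_zero_of_diag h0 y
  exact ⟨h1, by rw [← σ.posSemidef.isHermitian.apply, h1, star_zero]⟩

/-- The action on a state of `S ⊗ W` with wallet `|E_k⟩` of a permutation that sends `(i, k)` to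
`g i` and does so independently of `i` on the bath. -/
theorem permBranch_of_mem_walletSpec {d : ℕ} {B : Type} {k : Fin d} {σ : QState (Fin d × Fin d)}
    (hσ : σ ∈ walletSpec d k) {π : Equiv.Perm ((Fin d × Fin d) × B)} {b c : B}
    {g : Fin d → Fin d × Fin d} (hg : ∀ i, π ((i, k), b) = (g i, c)) (x y : Fin d × Fin d) :
    permBranch π σ.mat b x y =
      ∑ i, ∑ j, if g i = x ∧ g j = y then σ.mat (i, k) (j, k) else 0 := by
  classical
  simp only [permBranch, Matrix.of_apply, Fintype.sum_prod_type]
  refine Finset.sum_congr rfl fun i _ => ?_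
  rw [Finset.sum_eq_single k]
  · refine Finset.sum_congr rfl fun j _ => ?_
    rw [Finset.sum_eq_single k]
    · simp [hg, Prod.ext_iff]
    · intro w _ hw
      rw [(apply_eq_zero_of_mem_walletSpec hσ (x := (j, w)) hw _).2, ite_self]
    · simp
  · intro w _ hw
    refine Finset.sum_eq_zero fun j _ => Finset.sum_eq_zero fun v _ => ?_
    rw [(apply_eq_zero_of_mem_walletSpec hσ (x := (i, w)) hw _).1, ite_self]
  · simp

theorem traceSnd_apply_of_mem_walletSpec {d : ℕ} {k : Fin d} {σ : QState (Fin d × Fin d)}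
    (hσ : σ ∈ walletSpec d k) (i j : Fin d) : traceSnd σ.mat i j = σ.mat (i, k) (j, k) := by
  simp only [traceSnd, Matrix.of_apply]
  refine Finset.sum_eq_single k (fun w _ hw => ?_) (by simp)
  exact (apply_eq_zero_of_mem_walletSpec hσ (x := (i, w)) hw _).1

theorem sum_diag_of_mem_walletSpec {d : ℕ} {k : Fin d} {σ : QState (Fin d × Fin d)}
    (hσ : σ ∈ walletSpec d k) : ∑ i, σ.mat (i, k) (i, k) = 1 := by
  have := congrFun (congrFun hσ k) k
  simpa [traceFst] using this

/-! ### Lowering energy with a ladder bath -/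

/-- The involution of `Fin d × A × ℕ` exchanging `(k, a, n)` and `(t a, a, n + (k - t a))`. -/
def lowerFun {d : ℕ} {A : Type} (k : Fin d) (t : A → Fin d) (q : Fin d × A × ℕ) :
    Fin d × A × ℕ :=
  if q.1 = k then (t q.2.1, q.2.1, q.2.2 + (k - t q.2.1 : ℕ))
  else if q.1 = t q.2.1 ∧ (k - t q.2.1 : ℕ) ≤ q.2.2 then (k, q.2.1, q.2.2 - (k - t q.2.1 : ℕ))
  else q

/-- Ladder states too low to pay for raising `t a` to `k` are fixed; all others are matched in
pairs. If `t a = k` the shift is zero and nothing moves. -/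
theorem lowerFun_involutive {d : ℕ} {A : Type} {k : Fin d} {t : A → Fin d} :
    Function.Involutive (lowerFun k t) := by
  rintro ⟨s, a, n⟩
  by_cases hk : s = k
  · subst hk
    by_cases hs : t a = s
    · simp [lowerFun, hs]
    · simp [lowerFun, hs]
  · by_cases h : s = t a ∧ (k - t a : ℕ) ≤ n
    · have e : lowerFun k t (s, a, n) = (k, a, n - (k - t a : ℕ)) := by
        rw [lowerFun, if_neg hk, if_pos h]
      rw [e, lowerFun, if_pos rfl, Nat.sub_add_cancel h.2, h.1]
    · have e : lowerFun k t (s, a, n) = (s, a, n) := by rw [lowerFun, if_neg hk, if_neg h]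
      rw [e, e]

/-- The bound `t a ≤ k` makes the truncated subtraction exact, so the ladder gains what the wallet
loses. The label `a` is only a control and its energy cancels. -/
theorem lowerFun_energy {d : ℕ} {A : Type} {k : Fin d} {t : A → Fin d} (ht : ∀ a, t a ≤ k)
    (q : Fin d × A × ℕ) :
    ((lowerFun k t q).1 : ℕ) + (lowerFun k t q).2.2 = (q.1 : ℕ) + q.2.2 ∧
      (lowerFun k t q).2.1 = q.2.1 := by
  have h : (t q.2.1 : ℕ) ≤ k := ht q.2.1
  unfold lowerFun
  split_ifs with h1 h2
  · simp only [h1, and_true]; omega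
  · simp only [← h2.1, and_true]; simp only [← h2.1] at h; omega
  · simp

/-- The energies of a bath made of a ladder of spacing `Δ` and a system with Gibbs weights `p`. -/
noncomputable def ladderEnergy {A : Type} (β Δ : ℝ) (p : A → ℝ) (b : A × ℕ) : ℝ :=
  -Real.log (p b.1) / β + b.2 * Δ

theorem exp_ladderEnergy {A : Type} {β : ℝ} (hβ : 0 < β) (Δ : ℝ) {p : A → ℝ} (hp : ∀ a, 0 < p a)
    (b : A × ℕ) :
    Real.exp (-β * ladderEnergy β Δ p b) = p b.1 * Real.exp (-β * Δ) ^ b.2 := by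
  conv_rhs => rw [← Real.exp_log (hp b.1), ← Real.exp_nat_mul, ← Real.exp_add]
  rw [ladderEnergy]
  congr 1
  field_simp
  ring

theorem hasSum_ladder {A : Type} [Fintype A] {β Δ : ℝ} (hβ : 0 < β) (hΔ : 0 < Δ) (f : A → ℝ)
    (hf : ∀ a, 0 ≤ f a) :
    HasSum (fun b : A × ℕ => f b.1 * Real.exp (-β * Δ) ^ b.2)
      ((∑ a, f a) * (1 - Real.exp (-β * Δ))⁻¹) := by
  have hr : Real.exp (-β * Δ) < 1 := Real.exp_lt_one_iff.2 (by nlinarith)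
  have h1 := hasSum_fintype f
  have h2 := hasSum_geometric_of_lt_one (Real.exp_nonneg (-β * Δ)) hr
  exact h1.mul h2 (h1.summable.mul_of_nonneg h2.summable hf fun n => by positivity)

theorem summable_ladder {A : Type} [Fintype A] {β Δ : ℝ} (hβ : 0 < β) (hΔ : 0 < Δ) {p : A → ℝ}
    (hp : ∀ a, 0 < p a) : Summable fun b => Real.exp (-β * ladderEnergy β Δ p b) := by
  simp only [exp_ladderEnergy hβ Δ hp]
  exact (hasSum_ladder hβ hΔ p fun a => (hp a).le).summable

/-- The Gibbs state is a product: the geometric ladder factor is normalised away, and the label `a`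
is distributed according to `p`. -/
theorem hasSum_gibbsWeight_ladder {A : Type} [Fintype A] {β Δ : ℝ} (hβ : 0 < β) (hΔ : 0 < Δ)
    {p : A → ℝ} (hp : ∀ a, 0 < p a) (hp1 : ∑ a, p a = 1) (c : A → ℝ) (hc : ∀ a, 0 ≤ c a) :
    HasSum (fun b : A × ℕ => gibbsWeight β (ladderEnergy β Δ p) b * c b.1) (∑ a, p a * c a) := by
  have hr : Real.exp (-β * Δ) < 1 := Real.exp_lt_one_iff.2 (by nlinarith)
  have hZ := (hasSum_ladder hβ hΔ p fun a => (hp a).le).tsum_eq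
  have h := (hasSum_ladder hβ hΔ (fun a => p a * c a)
    fun a => mul_nonneg (hp a).le (hc a)).div_const (1 - Real.exp (-β * Δ))⁻¹
  rw [mul_div_assoc, div_self (inv_ne_zero (by linarith)), mul_one] at h
  refine h.congr_fun fun b => ?_
  simp only [gibbsWeight, exp_ladderEnergy hβ Δ hp, hZ, hp1, one_mul]
  ring

theorem coe_globalEnergy (d : ℕ) (Δ : ℝ≥0) (x : Fin d × Fin d) :
    globalEnergy d Δ x = ((x.1 : ℕ) + (x.2 : ℕ) + 2 : ℝ) * Δ := by
  simp only [globalEnergy, energyLevel, NNReal.coe_mul, NNReal.coe_add, NNReal.coe_natCast,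
    NNReal.coe_one]
  ring

/-- Lowering the wallet from `E_k` to `E_j` is a thermal operation that leaves `S` alone. -/
theorem exists_lower_wallet {d : ℕ} {β : ℝ} (hβ : 0 < β) {Δ : ℝ≥0} (hΔ : 0 < Δ) {j k : Fin d}
    (hjk : j ≤ k) :
    ∃ f, IsThermalOperation β (globalEnergy d Δ) f ∧ ∀ σ ∈ walletSpec d k,
      f σ ∈ walletSpec d j ∧ traceSnd (f σ).mat = traceSnd σ.mat := by
  have hs := summable_ladder (A := Unit) hβ (NNReal.coe_pos.2 hΔ) (p := fun _ => 1) (by simp)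
  let π : Equiv.Perm ((Fin d × Fin d) × Unit × ℕ) :=
    (Equiv.prodAssoc _ _ _).trans
      (((Equiv.refl (Fin d)).prodCongr
        (lowerFun_involutive (k := k) (t := fun _ : Unit => j)).toPerm).trans
        (Equiv.prodAssoc _ _ _).symm)
  have hπ : ∀ i w b, π ((i, w), b) =
      ((i, (lowerFun k (fun _ => j) (w, b)).1), (lowerFun k (fun _ => j) (w, b)).2) :=
    fun _ _ _ => rfl
  obtain ⟨f, hf, hfσ⟩ := exists_isThermalOperation_perm (E := globalEnergy d Δ) hs π (by
    rintro ⟨⟨i, w⟩, b⟩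
    obtain ⟨h1, h2⟩ := lowerFun_energy (t := fun _ : Unit => j) (fun _ => hjk) (w, b)
    have h1' : (((lowerFun k (fun _ : Unit => j) (w, b)).1 : ℕ) : ℝ) +
      ((lowerFun k (fun _ : Unit => j) (w, b)).2.2 : ℝ) = (w : ℕ) + b.2 := by exact_mod_cast h1
    rw [hπ]
    simp only [coe_globalEnergy, ladderEnergy]
    linear_combination (Δ : ℝ) * h1')
  refine ⟨f, hf, fun σ hσ => ?_⟩
  have hmat : ∀ x y, (f σ).mat x y =
      if x.2 = j ∧ y.2 = j then σ.mat (x.1, k) (y.1, k) else 0 := by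
    intro x y
    have h1 := Pi.hasSum.1 (Pi.hasSum.1 (hfσ σ) x) y
    have h2 := (Complex.hasSum_ofReal.2 (hasSum_gibbsWeight hs)).mul_right
      (if x.2 = j ∧ y.2 = j then σ.mat (x.1, k) (y.1, k) else 0)
    rw [Complex.ofReal_one, one_mul] at h2
    refine h1.unique (h2.congr_fun fun b => ?_)
    -- The output bath state does not depend on `i`, so coherences of `S` survive and every branch
    -- gives the same matrix.
    rw [Matrix.smul_apply, permBranch_of_mem_walletSpec hσ (g := fun i => (i, j))
      (c := (lowerFun k (fun _ => j) (k, b)).2) (by intro i; rw [hπ]; simp [lowerFun]), smul_eq_mul]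
    congr 1
    obtain ⟨i, w⟩ := x
    obtain ⟨i', w'⟩ := y
    simp only [Prod.mk.injEq]
    rw [Finset.sum_eq_single i, Finset.sum_eq_single i'] <;> simp +contextual [eq_comm]
  constructor
  · ext w w'
    simp only [traceFst, Matrix.of_apply, hmat, Matrix.single_apply]
    by_cases h : w = j ∧ w' = j
    · simp [h, sum_diag_of_mem_walletSpec hσ]
    · rw [if_neg (by tauto)]
      simp [h]
  · ext i i'
    rw [traceSnd_apply_of_mem_walletSpec hσ]
    simp [traceSnd, hmat]

/-- Commutation gives `M i j * (E_i - E_j) = 0`, and the spectrum is nondegenerate because `Δ > 0`.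
-/
theorem apply_eq_zero_of_commute_localHamiltonian {d : ℕ} {Δ : ℝ≥0} (hΔ : 0 < Δ)
    {M : Matrix (Fin d) (Fin d) ℂ} (h : Commute M (localHamiltonian d Δ)) {i j : Fin d}
    (hij : i ≠ j) : M i j = 0 := by
  have h1 := congrFun (congrFun h.eq i) j
  simp only [localHamiltonian, Matrix.mul_diagonal, Matrix.diagonal_mul, energyLevel,
    NNReal.coe_mul, NNReal.coe_add, NNReal.coe_natCast, NNReal.coe_one] at h1
  have h2 : (Δ : ℂ) ≠ 0 := by exact_mod_cast hΔ.ne'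
  have h3 : ((i : ℕ) : ℂ) - (j : ℕ) ≠ 0 :=
    sub_ne_zero.2 (by exact_mod_cast fun h => hij (Fin.ext h))
  have h4 : M i j * (((i : ℕ) : ℂ) - (j : ℕ)) * Δ = 0 := by
    push_cast at h1
    linear_combination -h1
  simpa [h2, h3] using h4

/-- From the wallet in its top level every state that is diagonal in energy can be prepared. -/
theorem exists_prepare_local {d : ℕ} {β : ℝ} (hβ : 0 < β) {Δ : ℝ≥0} (hΔ : 0 < Δ) {k : Fin d}
    (hk : ∀ i, i ≤ k) (ρ : QState (Fin d)) (hρ : Commute ρ.mat (localHamiltonian d Δ)) :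
    ∃ f, IsThermalOperation β (globalEnergy d Δ) f ∧ ∀ σ ∈ walletSpec d k, f σ ∈ localSpec ρ := by
  classical
  have hdiag : ∀ i, ((ρ.mat i i).re : ℂ) = ρ.mat i i ∧ 0 ≤ (ρ.mat i i).re := fun i => by
    have h := Complex.nonneg_iff.1 (ρ.posSemidef.diag_nonneg (i := i))
    exact ⟨Complex.ext rfl (by simpa using h.2), h.1⟩
  have hsum : ∑ i, (ρ.mat i i).re = 1 := by
    have h := congrArg Complex.re ρ.trace_eq_one
    simpa [Matrix.trace] using h
  -- Only the support of `ρ` enters: a label of probability zero would need infinite energy.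
  let A := {i : Fin d // 0 < (ρ.mat i i).re}
  let p : A → ℝ := fun a => (ρ.mat a.1 a.1).re
  have hp : ∀ a, 0 < p a := fun a => a.2
  have hpsum : ∀ c : Fin d → ℝ, ∑ a : A, p a * c a.1 = ∑ i, (ρ.mat i i).re * c i := by
    intro c
    rw [← Finset.sum_subtype (Finset.univ.filter fun i => 0 < (ρ.mat i i).re) (by simp)
      fun i => (ρ.mat i i).re * c i]
    refine Finset.sum_subset (Finset.subset_univ _) fun i _ hi => ?_
    rw [le_antisymm (by simpa using hi) (hdiag i).2, zero_mul]
  have hp1 : ∑ a, p a = 1 := by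
    have h := hpsum fun _ => 1
    simpa [hsum] using h
  have : Nonempty A := by
    by_contra h
    rw [not_nonempty_iff] at h
    simp at hp1
  have hs := summable_ladder hβ (NNReal.coe_pos.2 hΔ) hp
  let t : A → Fin d := Subtype.val
  -- Lowering of the wallet controlled by `a`, followed by the exchange of `S` and `W`.
  let π : Equiv.Perm ((Fin d × Fin d) × A × ℕ) :=
    (Equiv.prodAssoc _ _ _).trans
      (((Equiv.refl (Fin d)).prodCongr
        (lowerFun_involutive (k := k) (t := t)).toPerm).trans
        ((Equiv.prodAssoc _ _ _).symm.trans ((Equiv.prodComm _ _).prodCongr (Equiv.refl _))))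
  have hπ : ∀ i w b, π ((i, w), b) =
      (((lowerFun k t (w, b)).1, i), (lowerFun k t (w, b)).2) :=
    fun _ _ _ => rfl
  obtain ⟨f, hf, hfσ⟩ := exists_isThermalOperation_perm (E := globalEnergy d Δ) hs π (by
    rintro ⟨⟨i, w⟩, b⟩
    obtain ⟨h1, h2⟩ := lowerFun_energy (t := t) (fun a => hk _) (w, b)
    have h1' : (((lowerFun k t (w, b)).1 : ℕ) : ℝ) +
      ((lowerFun k t (w, b)).2.2 : ℝ) = (w : ℕ) + b.2 := by exact_mod_cast h1
    rw [hπ]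
    simp only [coe_globalEnergy, ladderEnergy, h2]
    linear_combination (Δ : ℝ) * h1')
  refine ⟨f, hf, fun σ hσ => ?_⟩
  ext s s'
  have h1 : HasSum _ (∑ u, (f σ).mat (s, u) (s', u)) := hasSum_sum (s := Finset.univ) fun u _ =>
    Pi.hasSum.1 (Pi.hasSum.1 (hfσ σ) (s, u)) (s', u)
  have h2 := Complex.hasSum_ofReal.2 (hasSum_gibbsWeight_ladder hβ (NNReal.coe_pos.2 hΔ) hp hp1
    (fun a => if a.1 = s ∧ a.1 = s' then 1 else 0) (fun a => by split_ifs <;> simp))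
  have hval : ((∑ a : A, p a * (if a.1 = s ∧ a.1 = s' then 1 else 0) : ℝ) : ℂ) = ρ.mat s s' := by
    rw [hpsum fun i => if i = s ∧ i = s' then 1 else 0]
    by_cases h : s = s'
    · subst h
      simp [(hdiag s).1]
    · rw [apply_eq_zero_of_commute_localHamiltonian hΔ hρ h, Finset.sum_eq_zero, Complex.ofReal_zero]
      intro i _
      rw [if_neg (by rintro ⟨rfl, h'⟩; exact h h'), mul_zero]
  rw [hval] at h2
  refine h1.unique (h2.congr_fun fun b => ?_)
  -- Given `a`, system `S` ends in `|a⟩` while `W` holds the old state of `S`, whose trace is one.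
  have hb : ∀ u, permBranch π σ.mat b (s, u) (s', u) =
      if b.1.1 = s ∧ b.1.1 = s' then σ.mat (u, k) (u, k) else 0 := by
    intro u
    rw [permBranch_of_mem_walletSpec hσ (g := fun i => (b.1.1, i))
      (c := (lowerFun k t (k, b)).2) (by intro i; rw [hπ]; simp [lowerFun, t])]
    simp only [Prod.mk.injEq]
    rw [Finset.sum_eq_single u, Finset.sum_eq_single u] <;> simp +contextual [eq_comm]
  simp only [Matrix.smul_apply, hb, smul_eq_mul, ← Finset.mul_sum, Complex.ofReal_mul]
  congr 1
  split_ifs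
  · simp [sum_diag_of_mem_walletSpec hσ]
  · simp

/-! ### Thermal operations do not decrease Gibbs-weighted dimension -/

/-- The `p`-th row of `U` consists of the conjugated coordinates of `U† e_p`, a vector of norm one.
-/
theorem sum_norm_matrixElement_sq_le {ι : Type*}
    {U : lp (fun _ : ι => ℂ) 2 →L[ℂ] lp (fun _ : ι => ℂ) 2} (hU : U ∈ unitary _) (p : ι)
    (s : Finset ι) : ∑ q ∈ s, ‖matrixElement U p q‖ ^ 2 ≤ 1 := by
  classical
  set v := ContinuousLinearMap.adjoint U (lp.single 2 p (1 : ℂ)) with hv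
  have hent : ∀ q, ‖matrixElement U p q‖ = ‖(v : ι → ℂ) q‖ := by
    intro q
    have h1 := ContinuousLinearMap.adjoint_inner_left U (lp.single 2 q (1 : ℂ))
      (lp.single 2 p (1 : ℂ))
    rw [← hv, lp.inner_single_right, lp.inner_single_left] at h1
    have h2 : matrixElement U p q = (U (lp.single 2 q (1 : ℂ)) : ι → ℂ) p := by
      unfold matrixElement
      congr!
    rw [h2]
    simpa using congrArg norm h1.symm
  have hnorm : ‖v‖ = 1 := by
    rw [hv, ← ContinuousLinearMap.star_eq_adjoint]
    have h := (Unitary.linearIsometryEquiv (⟨star U, Unitary.star_mem hU⟩ : unitary _)).norm_map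
      (lp.single 2 p (1 : ℂ))
    rw [lp.norm_single (by simp), norm_one] at h
    exact h
  have h := lp.sum_rpow_le_norm_rpow (p := 2) (by simp) v s
  simpa [hent, hnorm] using h

/-- The pure energy eigenstate `|x⟩⟨x|`. -/
noncomputable def basisState {X : Type*} [Fintype X] [DecidableEq X] (x : X) : QState X where
  mat := Matrix.single x x 1
  posSemidef := by
    rw [← Matrix.diagonal_single]
    exact Matrix.PosSemidef.diagonal (Pi.single_nonneg.2 zero_le_one)
  trace_eq_one := by simp

/-- Energy conservation gives detailed balance: the Boltzmann factor of system and bath can be moved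
from the input to the output of each transition. Summing over inputs first, unitarity bounds each
row of squared matrix elements by one, and the Gibbs weights of the output bath states sum to at
most one. -/
theorem IsThermalOperation.sum_exp_le {X : Type*} [Fintype X] [DecidableEq X] {β : ℝ} {E : X → ℝ}
    {f : QState X → QState X} (hf : IsThermalOperation β E f) {A A' : Finset X}
    (h : ∀ x ∈ A, ∑ y ∈ A', (f (basisState x)).mat y y = 1) :
    ∑ x ∈ A, Real.exp (-β * E x) ≤ ∑ y ∈ A', Real.exp (-β * E y) := by
  classical
  obtain ⟨B, _, e, U, he, hU, hE, hsum⟩ := hf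
  have hentry : ∀ x y, HasSum (fun b : B × B =>
      gibbsWeight β e b.2 * ‖matrixElement U (y, b.1) (x, b.2)‖ ^ 2)
      ((f (basisState x)).mat y y).re := by
    intro x y
    have h1 := Complex.hasSum_re (Pi.hasSum.1 (Pi.hasSum.1 (hsum (basisState x)) y) y)
    refine h1.congr_fun fun b => ?_
    have h2 : (bathElement U b.1 b.2 * (basisState x).mat *
        (bathElement U b.1 b.2).conjTranspose) y y =
        ((‖matrixElement U (y, b.1) (x, b.2)‖ ^ 2 : ℝ) : ℂ) := by
      rw [Complex.ofReal_pow, ← Complex.mul_conj']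
      simp [Matrix.mul_apply, basisState, bathElement, Matrix.single_apply, ite_and]
    rw [Matrix.smul_apply, h2, smul_eq_mul, ← Complex.ofReal_mul, Complex.ofReal_re]
  have hbal : ∀ x y b b', Real.exp (-β * E x) *
      (gibbsWeight β e b' * ‖matrixElement U (y, b) (x, b')‖ ^ 2) =
      Real.exp (-β * E y) * (gibbsWeight β e b * ‖matrixElement U (y, b) (x, b')‖ ^ 2) := by
    intro x y b b'
    by_cases hxy : E y + e b = E x + e b'
    · have hexp : Real.exp (-β * E x) * Real.exp (-β * e b') =
          Real.exp (-β * E y) * Real.exp (-β * e b) := by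
        rw [← Real.exp_add, ← Real.exp_add]
        congr 1
        linear_combination β * hxy
      simp only [gibbsWeight, div_eq_mul_inv]
      linear_combination (∑' b', Real.exp (-β * e b'))⁻¹ *
        ‖matrixElement U (y, b) (x, b')‖ ^ 2 * hexp
    · simp [hE (y, b) (x, b') hxy]
  have htot : HasSum (fun b : B × B => ∑ x ∈ A, ∑ y ∈ A', Real.exp (-β * E x) *
      (gibbsWeight β e b.2 * ‖matrixElement U (y, b.1) (x, b.2)‖ ^ 2))
      (∑ x ∈ A, Real.exp (-β * E x)) := by
    refine hasSum_sum fun x hx => ?_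
    have h1 : HasSum _ (∑ y ∈ A', Real.exp (-β * E x) * ((f (basisState x)).mat y y).re) :=
      hasSum_sum fun y _ => (hentry x y).mul_left (Real.exp (-β * E x))
    have h2 := congrArg Complex.re (h x hx)
    rw [Complex.re_sum, Complex.one_re] at h2
    rwa [← Finset.mul_sum, h2, mul_one] at h1
  refine hasSum_le_of_sum_le htot fun F => ?_
  have hg := gibbsWeight_nonneg β e
  calc ∑ b ∈ F, ∑ x ∈ A, ∑ y ∈ A', Real.exp (-β * E x) *
        (gibbsWeight β e b.2 * ‖matrixElement U (y, b.1) (x, b.2)‖ ^ 2)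
      -- Enlarging the finite set to a rectangle lets input and output bath states be summed
      -- separately.
      ≤ ∑ b ∈ F.image Prod.fst ×ˢ F.image Prod.snd, ∑ x ∈ A, ∑ y ∈ A', Real.exp (-β * E x) *
        (gibbsWeight β e b.2 * ‖matrixElement U (y, b.1) (x, b.2)‖ ^ 2) := by
        refine Finset.sum_le_sum_of_subset_of_nonneg Finset.subset_product fun b _ _ => ?_
        exact Finset.sum_nonneg fun x _ => Finset.sum_nonneg fun y _ =>
          mul_nonneg (Real.exp_nonneg _) (mul_nonneg (hg _) (sq_nonneg _))
    _ = ∑ y ∈ A', Real.exp (-β * E y) * ∑ b ∈ F.image Prod.fst, gibbsWeight β e b *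
        ∑ q ∈ A ×ˢ F.image Prod.snd, ‖matrixElement U (y, b) q‖ ^ 2 := by
        simp only [Finset.sum_product, Finset.mul_sum]
        rw [Finset.sum_comm (s := A')]
        refine Finset.sum_congr rfl fun b _ => ?_
        rw [Finset.sum_comm, Finset.sum_comm (s := A')]
        refine Finset.sum_congr rfl fun x _ => ?_
        rw [Finset.sum_comm]
        exact Finset.sum_congr rfl fun y _ => Finset.sum_congr rfl fun b' _ => hbal x y b b'
    _ ≤ ∑ y ∈ A', Real.exp (-β * E y) * 1 := by
        refine Finset.sum_le_sum fun y _ => mul_le_mul_of_nonneg_left ?_ (Real.exp_nonneg _)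
        refine le_trans (Finset.sum_le_sum fun b _ =>
          mul_le_mul_of_nonneg_left (sum_norm_matrixElement_sq_le hU (y, b) _) (hg b)) ?_
        simp only [mul_one]
        exact sum_le_hasSum _ (fun b _ => hg b) (hasSum_gibbsWeight he)
    _ = _ := by simp only [mul_one]

/-! ### Convertibility within the currency -/

theorem basisState_mem_walletSpec {d : ℕ} (i k : Fin d) : basisState (i, k) ∈ walletSpec d k := by
  ext w w'
  simp only [traceFst, basisState, Matrix.of_apply, Matrix.single_apply, Prod.mk.injEq]
  by_cases h : k = w ∧ k = w'
  · simp [h.1, ← h.2]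
  · rw [if_neg h]
    exact Finset.sum_eq_zero fun x _ => if_neg (by tauto)

theorem walletSpec_nonempty {d : ℕ} (k : Fin d) : (walletSpec d k).Nonempty :=
  ⟨_, basisState_mem_walletSpec k k⟩

theorem walletSpec_disjoint {d : ℕ} {j k : Fin d} {σ : QState (Fin d × Fin d)}
    (hj : σ ∈ walletSpec d j) (hk : σ ∈ walletSpec d k) : j = k := by
  by_contra h
  have h1 := congrFun (congrFun (Eq.trans hj.symm hk) j) j
  simp [Ne.symm h] at h1

theorem walletSpec_injective (d : ℕ) : Function.Injective (walletSpec d) := fun j _ h =>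
  walletSpec_disjoint (basisState_mem_walletSpec j j) (h ▸ basisState_mem_walletSpec j j)

theorem energyLevel_le_iff {d : ℕ} {Δ : ℝ≥0} (hΔ : 0 < Δ) {j k : Fin d} :
    energyLevel d Δ j ≤ energyLevel d Δ k ↔ j ≤ k := by
  rw [energyLevel, energyLevel, mul_le_mul_iff_left₀ hΔ, add_le_add_iff_right, Nat.cast_le,
    Fin.le_def]

theorem energyLevel_pos {d : ℕ} {Δ : ℝ≥0} (hΔ : 0 < Δ) (k : Fin d) : 0 < energyLevel d Δ k :=
  mul_pos (Nat.cast_add_one_pos (k : ℕ)) hΔ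

theorem reaches_iff {X : Type*} [Fintype X] {β : ℝ} {E : X → ℝ} {V W : Set (QState X)} :
    (thermalTheory β E).Reaches V W ↔ ∃ f, IsThermalOperation β E f ∧ ∀ σ ∈ V, f σ ∈ W := by
  constructor
  · rintro ⟨F, ⟨f, hf, rfl⟩, h⟩
    exact ⟨f, hf, fun σ hσ => h ⟨σ, hσ, rfl⟩⟩
  · rintro ⟨f, hf, h⟩
    exact ⟨_, ⟨f, hf, rfl⟩, by rintro _ ⟨σ, hσ, rfl⟩; exact h σ hσ⟩

/-- A bath with a single state and the trivial permutation suffice. -/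
theorem isThermalOperation_id {X : Type*} [Fintype X] (β : ℝ) (E : X → ℝ) :
    IsThermalOperation β E id := by
  classical
  obtain ⟨f, hf, h⟩ := exists_isThermalOperation_perm (B := Unit) (E := E) (β := β)
    (e := fun _ => 0) (Summable.of_finite) (Equiv.refl _) (fun _ => rfl)
  have hfid : f = id := by
    funext ρ
    have h1 := h ρ
    have h2 := (Complex.hasSum_ofReal.2 (hasSum_gibbsWeight (B := Unit) (β := β)
      (e := fun _ => 0) Summable.of_finite)).smul_const ρ.mat
    rw [Complex.ofReal_one, one_smul] at h2
    have hmat : (f ρ).mat = ρ.mat := h1.unique (h2.congr_fun fun b => by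
      congr 1
      ext x y
      simp only [permBranch, Matrix.of_apply, Equiv.refl_apply, Prod.mk.injEq, and_true]
      rw [Finset.sum_eq_single x, Finset.sum_eq_single y] <;> simp +contextual)
    cases hfr : f ρ
    cases ρ
    simp_all
  exact hfid ▸ hf

theorem reaches_of_subset {X : Type*} [Fintype X] {β : ℝ} {E : X → ℝ} {V W : Set (QState X)}
    (h : V ⊆ W) : (thermalTheory β E).Reaches V W :=
  reaches_iff.2 ⟨id, isThermalOperation_id β E, fun _ hσ => h hσ⟩

theorem sum_exp_globalEnergy (d : ℕ) (β : ℝ) (Δ : ℝ≥0) (s : Finset (Fin d)) :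
    ∑ x ∈ Finset.univ ×ˢ s, Real.exp (-β * globalEnergy d Δ x) =
      (∑ i, Real.exp (-β * energyLevel d Δ i)) * ∑ w ∈ s, Real.exp (-β * energyLevel d Δ w) := by
  rw [Finset.sum_mul_sum, Finset.sum_product]
  refine Finset.sum_congr rfl fun i _ => Finset.sum_congr rfl fun w _ => ?_
  rw [← Real.exp_add, globalEnergy, mul_add]

/-- The eigenstates `|i, k⟩` with arbitrary `i` and `k ∈ s` must all land in `S ⊗ |j⟩`; the
partition function of `S` is a common factor on both sides. -/
theorem sum_exp_le_of_reaches_walletSpec {d : ℕ} {β : ℝ} {Δ : ℝ≥0} {j : Fin d}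
    {s : Finset (Fin d)} {V : Set (QState (Fin d × Fin d))} (hV : ∀ k ∈ s, walletSpec d k ⊆ V)
    (h : (thermalTheory β (globalEnergy d Δ)).Reaches V (walletSpec d j)) :
    ∑ w ∈ s, Real.exp (-β * energyLevel d Δ w) ≤ Real.exp (-β * energyLevel d Δ j) := by
  obtain ⟨f, hf, hfV⟩ := reaches_iff.1 h
  have h1 := hf.sum_exp_le (A := Finset.univ ×ˢ s) (A' := Finset.univ ×ˢ {j}) (by
    rintro ⟨i, k⟩ hx
    rw [Finset.sum_product]
    simp only [Finset.sum_singleton]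
    exact sum_diag_of_mem_walletSpec
      (hfV _ (hV k (Finset.mem_product.1 hx).2 (basisState_mem_walletSpec i k))))
  rw [sum_exp_globalEnergy, sum_exp_globalEnergy, Finset.sum_singleton] at h1
  exact le_of_mul_le_mul_left h1 (Finset.sum_pos (fun _ _ => Real.exp_pos _) ⟨j, Finset.mem_univ j⟩)

theorem reaches_walletSpec_iff {d : ℕ} {β : ℝ} (hβ : 0 < β) {Δ : ℝ≥0} (hΔ : 0 < Δ) {j k : Fin d} :
    (thermalTheory β (globalEnergy d Δ)).Reaches (walletSpec d k) (walletSpec d j) ↔ j ≤ k := by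
  constructor
  · intro h
    have h1 := sum_exp_le_of_reaches_walletSpec (s := {k}) (by simp) h
    rw [Finset.sum_singleton, Real.exp_le_exp] at h1
    rw [← energyLevel_le_iff hΔ, ← NNReal.coe_le_coe]
    nlinarith
  · intro h
    obtain ⟨f, hf, hfσ⟩ := exists_lower_wallet hβ hΔ h
    exact reaches_iff.2 ⟨f, hf, fun σ hσ => (hfσ σ hσ).1⟩

/-- A second level exists, so the full wallet partition function strictly exceeds the single
Boltzmann factor of level `j`. -/
theorem not_reaches_univ_walletSpec {d : ℕ} (hd : 2 ≤ d) {β : ℝ} {Δ : ℝ≥0} {j : Fin d} :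
    ¬ (thermalTheory β (globalEnergy d Δ)).Reaches Set.univ (walletSpec d j) := by
  intro h
  have h1 := sum_exp_le_of_reaches_walletSpec (s := Finset.univ) (fun _ _ => Set.subset_univ _) h
  have : Nontrivial (Fin d) := Fin.nontrivial_iff_two_le.2 hd
  obtain ⟨k, hk⟩ := exists_ne j
  have h2 := Finset.add_le_sum (f := fun w => Real.exp (-β * energyLevel d Δ w))
    (fun _ _ => (Real.exp_pos _).le) (Finset.mem_univ k) (Finset.mem_univ j) hk
  have h3 := Real.exp_pos (-β * energyLevel d Δ k)
  linarith

/-- The wallet can be in the eigenstate `|E_k⟩` whatever the marginal state on `S`. -/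
theorem exists_mem_walletSpec_inter_localSpec {d : ℕ} (k : Fin d) (ρ : QState (Fin d)) :
    (walletSpec d k ∩ localSpec ρ).Nonempty := by
  have htr : ∑ i, ρ.mat i i = 1 := ρ.trace_eq_one
  refine ⟨⟨Matrix.kroneckerMap (· * ·) ρ.mat (basisState k).mat,
    ρ.posSemidef.kronecker (basisState k).posSemidef, ?_⟩, ?_, ?_⟩
  · rw [Matrix.trace_kronecker, ρ.trace_eq_one, (basisState k).trace_eq_one, one_mul]
  · ext w w'
    simp [traceFst, Matrix.kroneckerMap_apply, ← Finset.sum_mul, htr, basisState]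
  · ext i j
    have h := (basisState k).trace_eq_one
    simp only [Matrix.trace, Matrix.diag_apply] at h
    simp [traceSnd, Matrix.kroneckerMap_apply, ← Finset.mul_sum, h]

theorem isStageIICurrency_workCurrency (d : ℕ) (hd : 2 ≤ d) (β : ℝ) (hβ : 0 < β) (Δ : ℝ≥0)
    (hΔ : 0 < Δ) : (thermalTheory β (globalEnergy d Δ)).IsStageIICurrency
      (workCurrency d) (blockDiagonalTarget d Δ) := by
  -- Index `d - 1` is the top level `E_d`.
  let k₀ : Fin d := ⟨d - 1, by omega⟩
  have hk₀ : ∀ i, i ≤ k₀ := fun i => Fin.le_def.2 (by simp only [k₀]; omega)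
  have hcompat : ∀ c ∈ workCurrency d, ∀ V ∈ blockDiagonalTarget d Δ, (c ∩ V).Nonempty := by
    rintro _ (⟨k, rfl⟩ | rfl) _ (⟨ρ, -, rfl⟩ | rfl)
    · exact exists_mem_walletSpec_inter_localSpec k ρ
    · rw [Set.inter_univ]
      exact walletSpec_nonempty k
    · exact (exists_mem_walletSpec_inter_localSpec k₀ ρ).mono
        (Set.inter_subset_inter_left _ (Set.subset_univ _))
    · exact ⟨basisState (k₀, k₀), trivial, trivial⟩
  refine ⟨⟨fun c hc => ?_, fun V hV => ?_, univ_mem_workCurrency d, Or.inr rfl, ?_, ?_, ?_⟩,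
    hcompat, ?_⟩
  · exact (hcompat c hc Set.univ (Or.inr rfl)).mono Set.inter_subset_left
  · exact (hcompat _ (univ_mem_workCurrency d) V hV).mono Set.inter_subset_right
  · rintro _ (⟨k, rfl⟩ | rfl) _ (⟨j, rfl⟩ | rfl)
    · rw [reaches_walletSpec_iff hβ hΔ, reaches_walletSpec_iff hβ hΔ]
      exact le_total j k
    · exact Or.inl (reaches_of_subset (Set.subset_univ _))
    · exact Or.inr (reaches_of_subset (Set.subset_univ _))
    · exact Or.inl (reaches_of_subset subset_rfl)
  · rintro _ (⟨ρ, hρ, rfl⟩ | rfl)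
    · exact ⟨_, walletSpec_mem d k₀, reaches_iff.2 (exists_prepare_local hβ hΔ hk₀ ρ hρ)⟩
    · exact ⟨_, univ_mem_workCurrency d, reaches_of_subset subset_rfl⟩
  · exact fun V _ => ⟨_, univ_mem_workCurrency d, reaches_of_subset (Set.subset_univ _)⟩
  · rintro _ (⟨k, rfl⟩ | rfl) _ (⟨j, rfl⟩ | rfl) h V hV
    -- The given conversion may disturb `S`; only its existence is used, to get `j ≤ k`, and the
    -- lowering map replaces it.
    · obtain ⟨f, hf, hfσ⟩ := exists_lower_wallet hβ hΔ ((reaches_walletSpec_iff hβ hΔ).1 h)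
      refine reaches_iff.2 ⟨f, hf, fun σ hσ => ⟨(hfσ σ hσ.1).1, ?_⟩⟩
      obtain ⟨ρ, -, rfl⟩ | rfl := hV
      · exact (hfσ σ hσ.1).2.trans hσ.2
      · trivial
    · exact reaches_of_subset (Set.inter_subset_inter_left _ (Set.subset_univ _))
    · exact absurd h (not_reaches_univ_walletSpec hd)
    · exact reaches_of_subset subset_rfl

open scoped Classical in
/-- The value of the currency: the energy of the wallet, and zero for the trivial specification. -/
noncomputable def workValue (d : ℕ) (Δ : ℝ≥0) (c : workCurrency d) : ℝ≥0 :=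
  if h : ∃ k, c.1 = walletSpec d k then energyLevel d Δ h.choose else 0

theorem workValue_walletSpec (d : ℕ) (Δ : ℝ≥0) (k : Fin d) (h : walletSpec d k ∈ workCurrency d) :
    workValue d Δ ⟨walletSpec d k, h⟩ = energyLevel d Δ k := by
  have h : ∃ j, walletSpec d k = walletSpec d j := ⟨k, rfl⟩
  -- Distinct levels give distinct specifications, so the chosen level must be `k`.
  rw [workValue, dif_pos h, ← walletSpec_injective d h.choose_spec]

theorem workValue_univ {d : ℕ} (hd : 2 ≤ d) (Δ : ℝ≥0) (h : Set.univ ∈ workCurrency d) :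
    workValue d Δ ⟨Set.univ, h⟩ = 0 := by
  rw [workValue, dif_neg]
  rintro ⟨k, hk⟩
  have : Nontrivial (Fin d) := Fin.nontrivial_iff_two_le.2 hd
  obtain ⟨j, hj⟩ := exists_ne k
  -- An eigenstate with wallet level `j ≠ k` shows that the trivial specification is not a wallet
  -- specification.
  exact hj (walletSpec_disjoint (basisState_mem_walletSpec j j) (hk ▸ Set.mem_univ _))

theorem mainTheorem11 (d : ℕ) (hd : 2 ≤ d) (β : ℝ) (hβ : 0 < β) (Δ : ℝ≥0) (hΔ : 0 < Δ) :
    (thermalTheory β (globalEnergy d Δ)).IsStageIICurrency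
      (workCurrency d) (blockDiagonalTarget d Δ) ∧
    ∃ val : workCurrency d → ℝ≥0,
      (thermalTheory β (globalEnergy d Δ)).IsValue (workCurrency d) val ∧
      (∀ k : Fin d, val ⟨walletSpec d k, walletSpec_mem d k⟩ = energyLevel d Δ k) ∧
      val ⟨Set.univ, univ_mem_workCurrency d⟩ = 0 := by
  refine ⟨isStageIICurrency_workCurrency d hd β hβ Δ hΔ, workValue d Δ, ⟨?_, workValue_univ hd Δ⟩,
    fun k => workValue_walletSpec d Δ k _, workValue_univ hd Δ _⟩
  rintro ⟨c, hc⟩ ⟨c', hc'⟩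
  obtain ⟨j, rfl⟩ | rfl := id hc <;> obtain ⟨k, rfl⟩ | rfl := id hc'
  · rw [workValue_walletSpec, workValue_walletSpec, energyLevel_le_iff hΔ,
      reaches_walletSpec_iff hβ hΔ]
  · rw [workValue_walletSpec, workValue_univ hd]
    exact iff_of_false (energyLevel_pos hΔ j).not_ge (not_reaches_univ_walletSpec hd)
  · rw [workValue_univ hd]
    exact iff_of_true zero_le (reaches_of_subset (Set.subset_univ _))
  · exact iff_of_true le_rfl (reaches_of_subset subset_rfl)
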